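/- Let $m,n\in\mathbb N$, let $0<p<1$, and let $\Phi: M_m(\mathbb C)\to M_n(\mathbb C)$ be a unital Schwarz map, that is, a linear map with $\Phi(\mathbf 1)=\mathbf 1$ and $\Phi(K^*K)\ge \Phi(K)^*\Phi(K)$ (in the positive semidefinite order) for all $K\in M_m(\mathbb C)$. Let $\Phi^\dagger: M_n(\mathbb C)\to M_m(\mathbb C)$ be the adjoint of $\Phi$ for the Hilbert--Schmidt inner products, so that $\operatorname{tr}[X^*\Phi^\dagger(Y)]=\operatorname{tr}[\Phi(X)^*Y]$ for all $X\in M_m(\mathbb C)$, $Y\in M_n(\mathbb C)$. Then for every positive definite $A\in M_n(\mathbb C)$ and every invertible $B\in M_n(\mathbb C)$, $$\operatorname{tr}\big[(B^*A^{-p}B)^{1/(2-p)}\big]\ \ge\ \operatorname{tr}\big[(\Phi^\dagger(B)^*\,\Phi^\dagger(A)^{-p}\,\Phi^\dagger(B))^{1/(2-p)}\big].$$ Here real powers of positive semidefinite matrices are defined by the functional calculus; if $\Phi^\dagger(A)$ is singular, then $\Phi^\dagger(A)^{-p}$ denotes the $p$-th power of its Moore--Penrose generalized inverse. -/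

import Mathlib

open scoped Matrix ComplexOrder MatrixOrder

namespace SchwarzMono

/-- A Schwarz map between matrix algebras: a linear map `Φ` with `Φ(K* K) ≥ Φ(K)* Φ(K)` for every
matrix `K`, in the Loewner order (the difference is positive semidefinite). -/
def IsSchwarz {m n : ℕ}
    (Φ : Matrix (Fin m) (Fin m) ℂ →ₗ[ℂ] Matrix (Fin n) (Fin n) ℂ) : Prop :=
  ∀ K : Matrix (Fin m) (Fin m) ℂ, (Φ (Kᴴ * K) - (Φ K)ᴴ * Φ K).PosSemidef

/-- A unital map: it sends the identity matrix to the identity matrix. -/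
def IsUnital {m n : ℕ}
    (Φ : Matrix (Fin m) (Fin m) ℂ →ₗ[ℂ] Matrix (Fin n) (Fin n) ℂ) : Prop :=
  Φ 1 = 1

/-- The adjoint of `Φ` for the Hilbert-Schmidt inner products `⟨X, Y⟩ = tr (X* Y)`.  Its
`(i, j)` entry at `Y` is `⟨Φ E, Y⟩`, where `E` is the matrix unit with a one at `(i, j)`; the
defining property and uniqueness are proved below. -/
def hsAdjoint {m n : ℕ}
    (Φ : Matrix (Fin m) (Fin m) ℂ →ₗ[ℂ] Matrix (Fin n) (Fin n) ℂ) :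
    Matrix (Fin n) (Fin n) ℂ →ₗ[ℂ] Matrix (Fin m) (Fin m) ℂ where
  toFun Y := Matrix.of fun i j => ((Φ (Matrix.single i j 1))ᴴ * Y).trace
  map_add' Y Z := by
    ext i j
    simp [Matrix.mul_add]
  map_smul' c Y := by
    ext i j
    simp

theorem trace_hsAdjoint {m n : ℕ}
    (Φ : Matrix (Fin m) (Fin m) ℂ →ₗ[ℂ] Matrix (Fin n) (Fin n) ℂ)
    (X : Matrix (Fin m) (Fin m) ℂ) (Y : Matrix (Fin n) (Fin n) ℂ) :
    (Xᴴ * hsAdjoint Φ Y).trace = ((Φ X)ᴴ * Y).trace := by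
  have hX : Φ X = ∑ i, ∑ j, X i j • Φ (Matrix.single i j 1) := by
    conv_lhs => rw [Matrix.matrix_eq_sum_single X]
    simp only [map_sum]
    refine Finset.sum_congr rfl fun i _ => Finset.sum_congr rfl fun j _ => ?_
    rw [← map_smul, Matrix.smul_single, smul_eq_mul, mul_one]
  rw [hX]
  simp only [Matrix.conjTranspose_sum, Matrix.conjTranspose_smul, Matrix.sum_mul,
    Matrix.trace_sum, Matrix.smul_mul, Matrix.trace_smul, smul_eq_mul]
  rw [Finset.sum_comm]
  simp [Matrix.trace, Matrix.mul_apply, hsAdjoint]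

theorem hsAdjoint_unique {m n : ℕ}
    (Φ : Matrix (Fin m) (Fin m) ℂ →ₗ[ℂ] Matrix (Fin n) (Fin n) ℂ)
    (Ψ : Matrix (Fin n) (Fin n) ℂ → Matrix (Fin m) (Fin m) ℂ)
    (h : ∀ X Y, (Xᴴ * Ψ Y).trace = ((Φ X)ᴴ * Y).trace) (Y : Matrix (Fin n) (Fin n) ℂ) :
    Ψ Y = hsAdjoint Φ Y := by
  ext i j
  have := h (Matrix.single i j 1) Y
  simp only [hsAdjoint, LinearMap.coe_mk, AddHom.coe_mk, Matrix.of_apply]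
  rw [← this, Matrix.conjTranspose_single, star_one, Matrix.trace_single_mul]
  simp

/-- Mathlib's real powers of a positive semidefinite matrix, read off in an orthonormal eigenbasis:
each eigenvalue `x` becomes `x ^ y`.  As `(0 : ℝ) ^ y = 0` for `y ≠ 0`, a nonzero power of a singular
matrix vanishes on its kernel, so a negative power is the positive power of the Moore-Penrose
generalized inverse. -/
theorem rpow_eq_of_posSemidef {n : ℕ} (A : Matrix (Fin n) (Fin n) ℂ) (hA : A.PosSemidef)
    (y : ℝ) :
    A ^ y = hA.1.eigenvectorUnitary.val *
      Matrix.diagonal (fun i => ((hA.1.eigenvalues i ^ y : ℝ) : ℂ)) *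
        star hA.1.eigenvectorUnitary.val := by
  have h0 : 0 ≤ A := hA.nonneg
  rw [CFC.rpow_eq_cfc_real h0, hA.1.cfc_eq, Matrix.IsHermitian.cfc]
  rfl

end SchwarzMono

/-!
The Schwarz inequality gives `tr (Φ(K)* A Φ(K)) ≤ tr (K* Φ†(A) K)` and
`tr (Φ(K)* Φ(K) Z) ≤ tr (K* K Φ†(Z))`. Left multiplication by `A` and right multiplication by `Z`
commute, and `a ^ p * b ^ (1 - p)` is an integral over `t` of parallel sums of `a` and `t * b`. The
parallel sum `a * b / (a + b)` is the weight for which `a * b / (a + b) * ‖x‖²` is the infimum of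
`a * ‖y‖² + b * ‖z‖²` over all decompositions `x = y + z`, so it inherits contractivity. Hence `Φ`
also contracts the forms `tr (K* A ^ p K Z ^ (1 - p))`, and dually `Φ†` contracts the forms with the
inverse powers. Since `tr Y ^ s` is the infimum over positive definite `Z` of
`s * tr (Y Z ^ (1 - 1 / s)) + (1 - s) * tr Z`, the case `s = 1 / (2 - p)`, in which
`1 - 1 / s = -(1 - p)`, gives the theorem.
-/

open Matrix MeasureTheory

namespace SchwarzMono

theorem le_of_forall_pos_le_add_mul {x y c : ℝ} (h : ∀ ε > 0, x ≤ y + ε * c) : x ≤ y := by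
  have hlim : Filter.Tendsto (fun ε : ℝ => y + ε * c) (nhdsWithin 0 (Set.Ioi 0)) (nhds y) := by
    have : Continuous fun ε : ℝ => y + ε * c := by fun_prop
    simpa using (this.tendsto 0).mono_left nhdsWithin_le_nhds
  exact ge_of_tendsto hlim (Filter.eventually_of_mem self_mem_nhdsWithin h)

section WeightedNorm

variable {ι κ E F : Type*} [Fintype ι] [Fintype κ]
  [SeminormedAddCommGroup E] [SeminormedAddCommGroup F]

/-- The square of the weighted `ℓ²` norm with weights `a`. -/
noncomputable def weightedNormSq (a : ι → ℝ) (x : ι → E) : ℝ :=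
  ∑ i, a i * ‖x i‖ ^ 2

theorem parallel_mul_norm_add_sq_le {a b : ℝ} (ha : 0 ≤ a) (hb : 0 ≤ b) (x y : E) :
    a * b / (a + b) * ‖x + y‖ ^ 2 ≤ a * ‖x‖ ^ 2 + b * ‖y‖ ^ 2 := by
  rcases (add_nonneg ha hb).eq_or_lt with h | h
  · rw [← h, div_zero, zero_mul]
    positivity
  · calc a * b / (a + b) * ‖x + y‖ ^ 2
        ≤ a * b / (a + b) * (‖x‖ + ‖y‖) ^ 2 := by gcongr; exact norm_add_le x y
      _ ≤ a * ‖x‖ ^ 2 + b * ‖y‖ ^ 2 := by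
        rw [div_mul_eq_mul_div, div_le_iff₀ h]
        nlinarith [sq_nonneg (a * ‖x‖ - b * ‖y‖)]

theorem weightedNormSq_parallel_add_le {a b : ι → ℝ} (ha : 0 ≤ a) (hb : 0 ≤ b) (x y : ι → E) :
    weightedNormSq (a * b / (a + b)) (x + y) ≤ weightedNormSq a x + weightedNormSq b y := by
  rw [weightedNormSq, weightedNormSq, weightedNormSq, ← Finset.sum_add_distrib]
  exact Finset.sum_le_sum fun i _ => parallel_mul_norm_add_sq_le (ha i) (hb i) (x i) (y i)

theorem exists_add_eq_and_weightedNormSq_parallel_eq [NormedSpace ℝ E] {a b : ι → ℝ}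
    (ha : 0 ≤ a) (hb : 0 ≤ b) (x : ι → E) :
    ∃ y z, y + z = x ∧
      weightedNormSq a y + weightedNormSq b z = weightedNormSq (a * b / (a + b)) x := by
  let c : ι → ℝ := fun i => a i / (a i + b i)
  refine ⟨fun i => (1 - c i) • x i, fun i => c i • x i, funext fun i => ?_, ?_⟩
  · rw [Pi.add_apply, ← add_smul, sub_add_cancel, one_smul]
  · simp only [weightedNormSq, ← Finset.sum_add_distrib, norm_smul, mul_pow, Real.norm_eq_abs,
      sq_abs, ← mul_assoc, ← add_mul, Pi.mul_apply, Pi.div_apply, Pi.add_apply]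
    refine Finset.sum_congr rfl fun i _ => congrArg (· * ‖x i‖ ^ 2) ?_
    rcases (add_nonneg (ha i) (hb i)).eq_or_lt with h | h
    · have hai : a i = 0 := by linarith [show 0 ≤ a i from ha i, show 0 ≤ b i from hb i]
      have hbi : b i = 0 := by linarith
      simp [hai, hbi]
    · simp only [c]
      field_simp
      ring

theorem weightedNormSq_parallel_map_le [NormedSpace ℝ E] (T : (ι → E) →+ (κ → F))
    {a b : ι → ℝ} {a' b' : κ → ℝ} (ha : 0 ≤ a) (hb : 0 ≤ b) (ha' : 0 ≤ a') (hb' : 0 ≤ b')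
    (hTa : ∀ x, weightedNormSq a' (T x) ≤ weightedNormSq a x)
    (hTb : ∀ x, weightedNormSq b' (T x) ≤ weightedNormSq b x) (x : ι → E) :
    weightedNormSq (a' * b' / (a' + b')) (T x) ≤ weightedNormSq (a * b / (a + b)) x := by
  obtain ⟨y, z, rfl, hyz⟩ := exists_add_eq_and_weightedNormSq_parallel_eq ha hb x
  rw [← hyz, map_add]
  exact (weightedNormSq_parallel_add_le ha' hb' _ _).trans (add_le_add (hTa y) (hTb z))

theorem exists_measure_rpow_mul_rpow_eq_integral {p : ℝ} (hp : p ∈ Set.Ioo 0 1) :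
    ∃ μ : Measure ℝ, ∀ a b : ℝ, 0 ≤ a → 0 ≤ b →
      IntegrableOn (fun t => t ^ (p - 1) / t * (a * (t * b) / (a + t * b))) (Set.Ioi 0) μ ∧
      a ^ p * b ^ (1 - p) =
        ∫ t in Set.Ioi 0, t ^ (p - 1) / t * (a * (t * b) / (a + t * b)) ∂μ := by
  obtain ⟨μ, hμ⟩ := Real.exists_measure_rpow_eq_integral_rpowIntegrand₀₁ hp
  refine ⟨μ, fun a b ha hb => ?_⟩
  obtain ⟨hint, heq⟩ := hμ (a / b) (div_nonneg ha hb)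
  have hscale : Set.EqOn (fun t => b * p.rpowIntegrand₀₁ t (a / b))
      (fun t => t ^ (p - 1) / t * (a * (t * b) / (a + t * b))) (Set.Ioi 0) := by
    intro t (ht : 0 < t)
    simp only [Real.rpowIntegrand₀₁_eq_pow_div hp ht.le (div_nonneg ha hb)]
    rcases hb.eq_or_lt with rfl | hb
    · simp
    · have : t * b + a ≠ 0 := by positivity
      have : a + t * b ≠ 0 := by positivity
      field_simp
      ring
  refine ⟨IntegrableOn.congr_fun (hint.const_mul b) hscale measurableSet_Ioi, ?_⟩
  rw [← setIntegral_congr_fun measurableSet_Ioi hscale, integral_const_mul, ← heq]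
  rcases hb.eq_or_lt with rfl | hb
  · simp [Real.zero_rpow (sub_pos.2 hp.2).ne']
  · rw [Real.div_rpow ha hb.le, Real.rpow_sub hb, Real.rpow_one]
    ring

theorem integrable_weightedNormSq {α : Type*} [MeasurableSpace α] {μ : Measure α}
    {w : ι → α → ℝ} (hw : ∀ i, Integrable (w i) μ) (x : ι → E) :
    Integrable (fun t => weightedNormSq (fun i => w i t) x) μ :=
  integrable_finsetSum _ fun i _ => (hw i).mul_const _

theorem weightedNormSq_integral {α : Type*} [MeasurableSpace α] {μ : Measure α}
    {w : ι → α → ℝ} (hw : ∀ i, Integrable (w i) μ) (x : ι → E) :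
    weightedNormSq (fun i => ∫ t, w i t ∂μ) x = ∫ t, weightedNormSq (fun i => w i t) x ∂μ := by
  simp only [weightedNormSq]
  rw [integral_finsetSum _ fun i _ => (hw i).mul_const _]
  simp only [integral_mul_const]

theorem weightedNormSq_smul (c : ℝ) (a : ι → ℝ) (x : ι → E) :
    weightedNormSq (c • a) x = c * weightedNormSq a x := by
  simp only [weightedNormSq, Finset.mul_sum, Pi.smul_apply, smul_eq_mul, mul_assoc]

theorem weightedNormSq_rpow_mul_rpow_map_le [NormedSpace ℝ E] (T : (ι → E) →+ (κ → F))
    {a b : ι → ℝ} {a' b' : κ → ℝ} (ha : 0 ≤ a) (hb : 0 ≤ b) (ha' : 0 ≤ a') (hb' : 0 ≤ b')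
    (hTa : ∀ x, weightedNormSq a' (T x) ≤ weightedNormSq a x)
    (hTb : ∀ x, weightedNormSq b' (T x) ≤ weightedNormSq b x)
    {p : ℝ} (hp : p ∈ Set.Icc 0 1) (x : ι → E) :
    weightedNormSq (fun i => a' i ^ p * b' i ^ (1 - p)) (T x) ≤
      weightedNormSq (fun i => a i ^ p * b i ^ (1 - p)) x := by
  rcases hp.1.eq_or_lt with rfl | hp0
  · simpa using hTb x
  rcases hp.2.eq_or_lt with rfl | hp1
  · simpa using hTa x
  obtain ⟨μ, hμ⟩ := exists_measure_rpow_mul_rpow_eq_integral ⟨hp0, hp1⟩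
  have hint i := (hμ (a i) (b i) (ha i) (hb i)).1
  have hint' i := (hμ (a' i) (b' i) (ha' i) (hb' i)).1
  simp only [(hμ _ _ (ha _) (hb _)).2, (hμ _ _ (ha' _) (hb' _)).2]
  rw [weightedNormSq_integral hint, weightedNormSq_integral hint']
  refine setIntegral_mono_on (integrable_weightedNormSq hint' _)
    (integrable_weightedNormSq hint _) measurableSet_Ioi fun t (ht : 0 < t) => ?_
  have hTtb (y : ι → E) : weightedNormSq (t • b') (T y) ≤ weightedNormSq (t • b) y := by
    simpa only [weightedNormSq_smul] using mul_le_mul_of_nonneg_left (hTb y) ht.le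
  have hpar := weightedNormSq_parallel_map_le T ha (smul_nonneg ht.le hb) ha'
    (smul_nonneg ht.le hb') hTa hTtb x
  have hscale := mul_le_mul_of_nonneg_left hpar (show 0 ≤ t ^ (p - 1) / t by positivity)
  rwa [← weightedNormSq_smul, ← weightedNormSq_smul] at hscale

end WeightedNorm


section LeftRightForm

variable {𝕜 m n : Type*} [RCLike 𝕜] [Fintype m] [Fintype n]

/-- The quadratic form of the operator `K ↦ A * K * Z` for the Hilbert-Schmidt inner product. -/
noncomputable def leftRightForm (A : Matrix m m 𝕜) (Z : Matrix n n 𝕜) (K : Matrix m n 𝕜) : ℝ :=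
  RCLike.re (Kᴴ * (A * K * Z)).trace

theorem leftRightForm_conjTranspose (A : Matrix m m 𝕜) (Z : Matrix n n 𝕜) (K : Matrix n m 𝕜) :
    leftRightForm A Z Kᴴ = leftRightForm Z A K := by
  refine congrArg RCLike.re ?_
  calc (Kᴴᴴ * (A * Kᴴ * Z)).trace = (K * A * (Kᴴ * Z)).trace := by
        rw [conjTranspose_conjTranspose]
        simp only [Matrix.mul_assoc]
    _ = (Kᴴ * (Z * K * A)).trace := by
        rw [Matrix.trace_mul_comm]
        simp only [Matrix.mul_assoc]

theorem leftRightForm_one (A Z : Matrix n n 𝕜) [DecidableEq n] :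
    leftRightForm A Z 1 = RCLike.re (A * Z).trace := by
  simp [leftRightForm]

theorem re_trace_conjTranspose_mul_mul_mul (A : Matrix m m 𝕜) (Z : Matrix n n 𝕜)
    (K : Matrix m n 𝕜) : RCLike.re (Kᴴ * A * K * Z).trace = leftRightForm A Z K := by
  simp only [leftRightForm, Matrix.mul_assoc]

variable [DecidableEq m] [DecidableEq n] {A : Matrix m m 𝕜} {Z : Matrix n n 𝕜}

/-- The coordinates of a matrix `K` with respect to the eigenbases of `A` and `Z`, that is, the
entries of `Uᴴ * K * V`, where `U` and `V` are the unitaries diagonalizing `A` and `Z`. -/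
noncomputable def eigenCoords (hA : A.IsHermitian) (hZ : Z.IsHermitian) :
    Matrix m n 𝕜 ≃+ (m × n → 𝕜) where
  toFun K ij := (star hA.eigenvectorUnitary.val * K * hZ.eigenvectorUnitary.val) ij.1 ij.2
  invFun x := hA.eigenvectorUnitary.val * of (Function.curry x) * star hZ.eigenvectorUnitary.val
  left_inv K := by
    change hA.eigenvectorUnitary.val * (star hA.eigenvectorUnitary.val * K *
      hZ.eigenvectorUnitary.val) * star hZ.eigenvectorUnitary.val = K
    simp [← Matrix.mul_assoc, Matrix.mul_assoc _ hZ.eigenvectorUnitary.val]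
  right_inv x := by
    ext ⟨i, j⟩
    simp [← Matrix.mul_assoc, Matrix.mul_assoc _ (star hZ.eigenvectorUnitary.val)]
  map_add' K L := by
    ext ij
    simp [Matrix.mul_add, Matrix.add_mul]

theorem trace_conjTranspose_mul_eq_sum_eigenCoords (hA : A.IsHermitian) (hZ : Z.IsHermitian)
    (K L : Matrix m n 𝕜) :
    (Kᴴ * L).trace = ∑ ij, star (eigenCoords hA hZ K ij) * eigenCoords hA hZ L ij := by
  set U := hA.eigenvectorUnitary
  set V := hZ.eigenvectorUnitary
  calc (Kᴴ * L).trace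
      = (Kᴴ * (U.val * star U.val) * L * (V.val * star V.val)).trace := by simp
    _ = ((star U.val * K * V.val)ᴴ * (star U.val * L * V.val)).trace := by
        simp only [conjTranspose_mul, star_eq_conjTranspose, conjTranspose_conjTranspose]
        rw [← Matrix.mul_assoc, Matrix.trace_mul_comm]
        simp only [Matrix.mul_assoc]
    _ = ∑ ij, star (eigenCoords hA hZ K ij) * eigenCoords hA hZ L ij := by
        rw [Fintype.sum_prod_type_right]
        rfl

theorem eigenCoords_rpow_mul_mul_rpow (hA : A.PosSemidef) (hZ : Z.PosSemidef) (x y : ℝ)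
    (K : Matrix m n 𝕜) (ij : m × n) :
    eigenCoords hA.1 hZ.1 (A ^ x * K * Z ^ y) ij =
      ((hA.1.eigenvalues ij.1 ^ x * hZ.1.eigenvalues ij.2 ^ y : ℝ) : 𝕜) *
        eigenCoords hA.1 hZ.1 K ij := by
  set U := hA.1.eigenvectorUnitary
  set V := hZ.1.eigenvectorUnitary
  set a : m → 𝕜 := fun i => (hA.1.eigenvalues i ^ x : ℝ)
  set z : n → 𝕜 := fun j => (hZ.1.eigenvalues j ^ y : ℝ)
  have hAx : A ^ x = U.val * diagonal a * star U.val := by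
    rw [CFC.rpow_eq_cfc_real hA.nonneg, hA.1.cfc_eq]
    rfl
  have hZy : Z ^ y = V.val * diagonal z * star V.val := by
    rw [CFC.rpow_eq_cfc_real hZ.nonneg, hZ.1.cfc_eq]
    rfl
  have hdiag : star U.val * (A ^ x * K * Z ^ y) * V.val =
      diagonal a * (star U.val * K * V.val) * diagonal z :=
    calc star U.val * (A ^ x * K * Z ^ y) * V.val
        = (star U.val * U.val) * diagonal a * (star U.val * K * V.val) * diagonal z *
            (star V.val * V.val) := by simp only [hAx, hZy, Matrix.mul_assoc]
      _ = diagonal a * (star U.val * K * V.val) * diagonal z := by simp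
  calc eigenCoords hA.1 hZ.1 (A ^ x * K * Z ^ y) ij
      = (diagonal a * (star U.val * K * V.val) * diagonal z) ij.1 ij.2 := by rw [← hdiag]; rfl
    _ = ((hA.1.eigenvalues ij.1 ^ x * hZ.1.eigenvalues ij.2 ^ y : ℝ) : 𝕜) *
          eigenCoords hA.1 hZ.1 K ij := by
        rw [mul_diagonal, diagonal_mul, RCLike.ofReal_mul, mul_right_comm]
        rfl

theorem leftRightForm_rpow_rpow (hA : A.PosSemidef) (hZ : Z.PosSemidef) (x y : ℝ)
    (K : Matrix m n 𝕜) :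
    leftRightForm (A ^ x) (Z ^ y) K = weightedNormSq
      (fun ij : m × n => hA.1.eigenvalues ij.1 ^ x * hZ.1.eigenvalues ij.2 ^ y)
      (eigenCoords hA.1 hZ.1 K) := by
  have hnorm (k : 𝕜) : RCLike.re (star k * k) = ‖k‖ ^ 2 := by
    rw [RCLike.star_def, RCLike.conj_mul]
    norm_cast
  rw [leftRightForm, trace_conjTranspose_mul_eq_sum_eigenCoords hA.1 hZ.1, map_sum]
  refine Finset.sum_congr rfl fun ij _ => ?_
  rw [eigenCoords_rpow_mul_mul_rpow hA hZ, mul_left_comm, RCLike.re_ofReal_mul, hnorm]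

theorem leftRightForm_one_right (hA : A.PosSemidef) (hZ : Z.PosSemidef) (K : Matrix m n 𝕜) :
    leftRightForm A 1 K =
      weightedNormSq (fun ij : m × n => hA.1.eigenvalues ij.1) (eigenCoords hA.1 hZ.1 K) := by
  simpa [CFC.rpow_one A hA.nonneg, CFC.rpow_zero Z hZ.nonneg] using
    leftRightForm_rpow_rpow hA hZ 1 0 K

theorem leftRightForm_one_left (hA : A.PosSemidef) (hZ : Z.PosSemidef) (K : Matrix m n 𝕜) :
    leftRightForm 1 Z K =
      weightedNormSq (fun ij : m × n => hZ.1.eigenvalues ij.2) (eigenCoords hA.1 hZ.1 K) := by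
  simpa [CFC.rpow_zero A hA.nonneg, CFC.rpow_one Z hZ.nonneg] using
    leftRightForm_rpow_rpow hA hZ 0 1 K

theorem leftRightForm_rpow_map_le {m' n' : Type*} [Fintype m'] [Fintype n'] [DecidableEq m']
    [DecidableEq n'] {A' : Matrix m' m' 𝕜} {Z' : Matrix n' n' 𝕜}
    (Φ : Matrix m n 𝕜 →+ Matrix m' n' 𝕜)
    (hA : A.PosSemidef) (hZ : Z.PosSemidef) (hA' : A'.PosSemidef) (hZ' : Z'.PosSemidef)
    (hΦA : ∀ K, leftRightForm A' 1 (Φ K) ≤ leftRightForm A 1 K)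
    (hΦZ : ∀ K, leftRightForm 1 Z' (Φ K) ≤ leftRightForm 1 Z K)
    {p : ℝ} (hp : p ∈ Set.Icc 0 1) (K : Matrix m n 𝕜) :
    leftRightForm (A' ^ p) (Z' ^ (1 - p)) (Φ K) ≤ leftRightForm (A ^ p) (Z ^ (1 - p)) K := by
  let T : (m × n → 𝕜) →+ (m' × n' → 𝕜) := (eigenCoords hA'.1 hZ'.1).toAddMonoidHom.comp
    (Φ.comp (eigenCoords hA.1 hZ.1).symm.toAddMonoidHom)
  have hT (x : m × n → 𝕜) :
      T x = eigenCoords hA'.1 hZ'.1 (Φ ((eigenCoords hA.1 hZ.1).symm x)) := rfl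
  have hTA (x : m × n → 𝕜) : weightedNormSq (fun ij => hA'.1.eigenvalues ij.1) (T x) ≤
      weightedNormSq (fun ij => hA.1.eigenvalues ij.1) x := by
    rw [hT, ← leftRightForm_one_right hA' hZ']
    simpa [leftRightForm_one_right hA hZ] using hΦA ((eigenCoords hA.1 hZ.1).symm x)
  have hTZ (x : m × n → 𝕜) : weightedNormSq (fun ij => hZ'.1.eigenvalues ij.2) (T x) ≤
      weightedNormSq (fun ij => hZ.1.eigenvalues ij.2) x := by
    rw [hT, ← leftRightForm_one_left hA' hZ']
    simpa [leftRightForm_one_left hA hZ] using hΦZ ((eigenCoords hA.1 hZ.1).symm x)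
  have h := weightedNormSq_rpow_mul_rpow_map_le T (fun ij => hA.eigenvalues_nonneg ij.1)
    (fun ij => hZ.eigenvalues_nonneg ij.2) (fun ij => hA'.eigenvalues_nonneg ij.1)
    (fun ij => hZ'.eigenvalues_nonneg ij.2) hTA hTZ hp (eigenCoords hA.1 hZ.1 K)
  rwa [hT, AddEquiv.symm_apply_apply, ← leftRightForm_rpow_rpow hA hZ,
    ← leftRightForm_rpow_rpow hA' hZ'] at h

theorem two_mul_re_trace_le (hA : A.PosDef) (hZ : Z.PosDef) (x y : ℝ) (K B : Matrix m n 𝕜) :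
    2 * RCLike.re (Kᴴ * B).trace ≤
      leftRightForm (A ^ x) (Z ^ y) K + leftRightForm (A ^ (-x)) (Z ^ (-y)) B := by
  rw [leftRightForm_rpow_rpow hA.posSemidef hZ.posSemidef,
    leftRightForm_rpow_rpow hA.posSemidef hZ.posSemidef,
    trace_conjTranspose_mul_eq_sum_eigenCoords hA.1 hZ.1, map_sum, weightedNormSq, weightedNormSq,
    ← Finset.sum_add_distrib, Finset.mul_sum]
  refine Finset.sum_le_sum fun ij _ => ?_
  have hi := hA.eigenvalues_pos ij.1
  have hj := hZ.eigenvalues_pos ij.2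
  set w := hA.1.eigenvalues ij.1 ^ x * hZ.1.eigenvalues ij.2 ^ y with hw
  have hwpos : 0 < w := by positivity
  rw [Real.rpow_neg hi.le, Real.rpow_neg hj.le, ← mul_inv, ← hw]
  set k := eigenCoords hA.1 hZ.1 K ij
  set b := eigenCoords hA.1 hZ.1 B ij
  have hkb : RCLike.re (star k * b) ≤ ‖k‖ * ‖b‖ :=
    (RCLike.re_le_norm _).trans_eq (by rw [norm_mul, norm_star])
  have hsq : 0 ≤ w⁻¹ * (w * ‖k‖ - ‖b‖) ^ 2 := by positivity
  have hexpand : w⁻¹ * (w * ‖k‖ - ‖b‖) ^ 2 = w * ‖k‖ ^ 2 + w⁻¹ * ‖b‖ ^ 2 - 2 * (‖k‖ * ‖b‖) := by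
    field_simp
    ring
  linarith

theorem leftRightForm_rpow_rpow_mul_mul (hA : A.PosSemidef) (hZ : Z.PosSemidef) (x y : ℝ)
    (B : Matrix m n 𝕜) :
    leftRightForm (A ^ x) (Z ^ y) (A ^ (-x) * B * Z ^ (-y)) =
      leftRightForm (A ^ (-x)) (Z ^ (-y)) B := by
  rw [leftRightForm_rpow_rpow hA hZ, leftRightForm_rpow_rpow hA hZ, weightedNormSq,
    weightedNormSq]
  refine Finset.sum_congr rfl fun ij _ => ?_
  rw [eigenCoords_rpow_mul_mul_rpow hA hZ, norm_mul, mul_pow, RCLike.norm_ofReal, sq_abs,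
    ← mul_assoc, Real.rpow_neg (hA.eigenvalues_nonneg _), Real.rpow_neg (hZ.eigenvalues_nonneg _),
    ← mul_inv]
  set w := hA.1.eigenvalues ij.1 ^ x * hZ.1.eigenvalues ij.2 ^ y
  rcases eq_or_ne w 0 with hw | hw
  · simp [hw]
  · field_simp

theorem leftRightForm_rpow_neg_le_of_map_le {m' n' : Type*} [Fintype m'] [Fintype n']
    [DecidableEq m'] [DecidableEq n'] {A' : Matrix m' m' 𝕜} {Z' : Matrix n' n' 𝕜}
    {Φ : Matrix m n 𝕜 → Matrix m' n' 𝕜} {B : Matrix m n 𝕜} {B' : Matrix m' n' 𝕜}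
    (hA : A.PosSemidef) (hZ : Z.PosSemidef) (hA' : A'.PosDef) (hZ' : Z'.PosDef)
    (hB : ∀ K, RCLike.re (Kᴴ * B).trace = RCLike.re ((Φ K)ᴴ * B').trace) {x y : ℝ}
    (hΦ : ∀ K, leftRightForm (A' ^ x) (Z' ^ y) (Φ K) ≤ leftRightForm (A ^ x) (Z ^ y) K) :
    leftRightForm (A ^ (-x)) (Z ^ (-y)) B ≤ leftRightForm (A' ^ (-x)) (Z' ^ (-y)) B' := by
  let W := A ^ (-x) * B * Z ^ (-y)
  have hW : RCLike.re (Wᴴ * B).trace = leftRightForm (A ^ (-x)) (Z ^ (-y)) B := by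
    rw [leftRightForm, ← RCLike.conj_re, starRingEnd_apply, ← trace_conjTranspose,
      conjTranspose_mul, conjTranspose_conjTranspose]
  have hWform : leftRightForm (A ^ x) (Z ^ y) W = leftRightForm (A ^ (-x)) (Z ^ (-y)) B :=
    leftRightForm_rpow_rpow_mul_mul hA hZ x y B
  have hdual := two_mul_re_trace_le hA' hZ' x y (Φ W) B'
  rw [← hB] at hdual
  linarith [hΦ W]

end LeftRightForm


section Trace

theorem rpow_le_mul_mul_rpow_add {y z s : ℝ} (hy : 0 ≤ y) (hz : 0 < z) (hs0 : 0 < s)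
    (hs1 : s ≤ 1) : y ^ s ≤ s * (y * z ^ (1 - s⁻¹)) + (1 - s) * z := by
  have hzs : 0 ≤ z ^ (1 - s⁻¹) := by positivity
  calc y ^ s = (y * z ^ (1 - s⁻¹)) ^ s * z ^ (1 - s) := by
        rw [Real.mul_rpow hy hzs, ← Real.rpow_mul hz.le, mul_assoc, ← Real.rpow_add hz,
          show (1 - s⁻¹) * s + (1 - s) = 0 by field_simp; ring, Real.rpow_zero, mul_one]
    _ ≤ s * (y * z ^ (1 - s⁻¹)) + (1 - s) * z :=
        Real.geom_mean_le_arith_mean2_weighted hs0.le (sub_nonneg.2 hs1) (mul_nonneg hy hzs) hz.le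
          (by ring)

theorem mul_rpow_add_rpow_le {y s ε : ℝ} (hy : 0 ≤ y) (hs0 : 0 < s) (hs1 : s ≤ 1) (hε : 0 ≤ ε) :
    y * (y ^ s + ε) ^ (1 - s⁻¹) ≤ y ^ s := by
  rcases hy.eq_or_lt with rfl | hy
  · simp [Real.zero_rpow hs0.ne']
  · calc y * (y ^ s + ε) ^ (1 - s⁻¹) ≤ y * (y ^ s) ^ (1 - s⁻¹) := by
          refine mul_le_mul_of_nonneg_left ?_ hy.le
          exact Real.rpow_le_rpow_of_nonpos (by positivity) (le_add_of_nonneg_right hε)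
            (sub_nonpos.2 ((one_le_inv₀ hs0).2 hs1))
      _ = y ^ (1 : ℝ) * y ^ (s * (1 - s⁻¹)) := by rw [← Real.rpow_mul hy.le, Real.rpow_one]
      _ = y ^ s := by
          rw [← Real.rpow_add hy]
          congr 1
          field_simp
          ring

variable {𝕜 n : Type*} [RCLike 𝕜] [Fintype n]

theorem trace_mul_le_of_le {P Q A : Matrix n n 𝕜} (hPQ : P ≤ Q) (hA : A.PosSemidef) :
    (P * A).trace ≤ (Q * A).trace := by
  classical
  obtain ⟨C, rfl⟩ := CStarAlgebra.nonneg_iff_eq_star_mul_self.1 hA.nonneg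
  have hconj (X : Matrix n n 𝕜) : (X * (star C * C)).trace = (C * X * star C).trace := by
    rw [Matrix.trace_mul_comm, Matrix.mul_assoc, Matrix.trace_mul_comm (star C)]
  rw [hconj, hconj]
  exact (tracePositiveLinearMap n ℝ 𝕜).monotone' (star_right_conjugate_le_conjugate hPQ C)

theorem re_trace_mul_le_of_le {P Q A : Matrix n n 𝕜} (hPQ : P ≤ Q) (hA : A.PosSemidef) :
    RCLike.re (P * A).trace ≤ RCLike.re (Q * A).trace :=
  RCLike.re_le_re (trace_mul_le_of_le hPQ hA)

variable [DecidableEq n]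

theorem re_trace_rpow_le {Y Z : Matrix n n 𝕜} (hY : Y.PosSemidef) (hZ : Z.PosDef) {s : ℝ}
    (hs0 : 0 < s) (hs1 : s ≤ 1) :
    RCLike.re (Y ^ s).trace ≤
      s * RCLike.re (Y * Z ^ (1 - s⁻¹)).trace + (1 - s) * RCLike.re Z.trace := by
  have hZ0 := hZ.posSemidef
  have hYs := leftRightForm_rpow_rpow hY hZ0 s 0 1
  have hYZ := leftRightForm_rpow_rpow hY hZ0 1 (1 - s⁻¹) 1
  have hZ1 := leftRightForm_rpow_rpow hY hZ0 0 1 1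
  simp only [leftRightForm_one, CFC.rpow_zero Y hY.nonneg, CFC.rpow_zero Z hZ0.nonneg,
    CFC.rpow_one Y hY.nonneg, CFC.rpow_one Z hZ0.nonneg, Real.rpow_zero,
    Real.rpow_one, mul_one, one_mul] at hYs hYZ hZ1
  rw [hYs, hYZ, hZ1, ← weightedNormSq_smul, ← weightedNormSq_smul, weightedNormSq, weightedNormSq,
    weightedNormSq, ← Finset.sum_add_distrib]
  refine Finset.sum_le_sum fun ij _ => ?_
  rw [← add_mul]
  exact mul_le_mul_of_nonneg_right (rpow_le_mul_mul_rpow_add (hY.eigenvalues_nonneg _)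
    (hZ.eigenvalues_pos _) hs0 hs1) (sq_nonneg _)

theorem mul_rpow_add_smul_one_rpow_le {Y : Matrix n n 𝕜} (hY : Y.PosSemidef) {s ε : ℝ}
    (hs0 : 0 < s) (hs1 : s ≤ 1) (hε : 0 ≤ ε) :
    Y * (Y ^ s + ε • (1 : Matrix n n 𝕜)) ^ (1 - s⁻¹) ≤ Y ^ s := by
  have hcont (f : ℝ → ℝ) : ContinuousOn f (spectrum ℝ Y) := Y.finite_real_spectrum.continuousOn f
  have hadd : Y ^ s + ε • (1 : Matrix n n 𝕜) = cfc (fun y : ℝ => y ^ s + ε) Y := by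
    rw [cfc_add_const ε (fun y : ℝ => y ^ s) Y (hcont _) hY.1.isSelfAdjoint,
      CFC.rpow_eq_cfc_real hY.nonneg, Algebra.algebraMap_eq_smul_one]
  have hnonneg : 0 ≤ Y ^ s + ε • (1 : Matrix n n 𝕜) :=
    add_nonneg CFC.rpow_nonneg (smul_nonneg hε zero_le_one)
  calc Y * (Y ^ s + ε • (1 : Matrix n n 𝕜)) ^ (1 - s⁻¹)
      = cfc (fun y : ℝ => y * (y ^ s + ε) ^ (1 - s⁻¹)) Y := by
        rw [CFC.rpow_eq_cfc_real hnonneg, hadd,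
          ← cfc_comp' (fun x : ℝ => x ^ (1 - s⁻¹)) (fun y : ℝ => y ^ s + ε) Y
            ((Y.finite_real_spectrum.image _).continuousOn _) (hcont _) hY.1.isSelfAdjoint,
          cfc_mul _ _ Y (hcont _) (hcont _), cfc_id' ℝ Y hY.1.isSelfAdjoint]
    _ ≤ cfc (fun y : ℝ => y ^ s) Y := cfc_mono (fun y hy =>
        mul_rpow_add_rpow_le (spectrum_nonneg_of_nonneg hY.nonneg hy) hs0 hs1 hε)
        (hcont _) (hcont _)
    _ = Y ^ s := (CFC.rpow_eq_cfc_real hY.nonneg).symm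

theorem isGLB_re_trace_rpow {Y : Matrix n n 𝕜} (hY : Y.PosSemidef) {s : ℝ}
    (hs0 : 0 < s) (hs1 : s ≤ 1) :
    IsGLB ((fun Z => s * RCLike.re (Y * Z ^ (1 - s⁻¹)).trace + (1 - s) * RCLike.re Z.trace) ''
      {Z | Z.PosDef}) (RCLike.re (Y ^ s).trace) := by
  refine ⟨?_, fun c hc => le_of_forall_pos_le_add_mul
    (c := (1 - s) * RCLike.re (1 : Matrix n n 𝕜).trace) fun ε hε => ?_⟩
  · rintro _ ⟨Z, hZ, rfl⟩
    exact re_trace_rpow_le hY hZ hs0 hs1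
  · have hpd : (Y ^ s + ε • (1 : Matrix n n 𝕜)).PosDef :=
      .posSemidef_add (Matrix.nonneg_iff_posSemidef.1 CFC.rpow_nonneg) (PosDef.one.smul hε)
    have htrace : RCLike.re (Y ^ s + ε • (1 : Matrix n n 𝕜)).trace =
        RCLike.re (Y ^ s).trace + ε * RCLike.re (1 : Matrix n n 𝕜).trace := by
      rw [trace_add, trace_smul, map_add, RCLike.smul_re]
    calc c ≤ s * RCLike.re (Y * (Y ^ s + ε • (1 : Matrix n n 𝕜)) ^ (1 - s⁻¹)).trace +
          (1 - s) * RCLike.re (Y ^ s + ε • (1 : Matrix n n 𝕜)).trace := hc ⟨_, hpd, rfl⟩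
      _ ≤ s * RCLike.re (Y ^ s).trace + (1 - s) *
          (RCLike.re (Y ^ s).trace + ε * RCLike.re (1 : Matrix n n 𝕜).trace) := by
        rw [htrace]
        refine add_le_add_left (mul_le_mul_of_nonneg_left ?_ hs0.le) _
        simpa using re_trace_mul_le_of_le (mul_rpow_add_smul_one_rpow_le hY hs0 hs1 hε.le) .one
      _ = RCLike.re (Y ^ s).trace + ε * ((1 - s) * RCLike.re (1 : Matrix n n 𝕜).trace) := by ring

end Trace


section Schwarz

variable {m n : ℕ} {Φ : Matrix (Fin m) (Fin m) ℂ →ₗ[ℂ] Matrix (Fin n) (Fin n) ℂ}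

theorem map_conjTranspose_of_map_nonneg (hΦ : ∀ X, 0 ≤ X → 0 ≤ Φ X)
    (K : Matrix (Fin m) (Fin m) ℂ) : Φ Kᴴ = (Φ K)ᴴ :=
  map_star (PositiveLinearMap.mk₀ Φ hΦ) K

theorem hsAdjoint_conjTranspose (hΦ : ∀ K, Φ Kᴴ = (Φ K)ᴴ) (Y : Matrix (Fin n) (Fin n) ℂ) :
    hsAdjoint Φ Yᴴ = (hsAdjoint Φ Y)ᴴ := by
  ext i j
  change ((Φ (single i j 1))ᴴ * Yᴴ).trace = star ((Φ (single j i 1))ᴴ * Y).trace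
  rw [← trace_conjTranspose, conjTranspose_mul, conjTranspose_conjTranspose, ← hΦ,
    conjTranspose_single, star_one, Matrix.trace_mul_comm]

theorem posSemidef_hsAdjoint (hΦ : ∀ X, 0 ≤ X → 0 ≤ Φ X) {A : Matrix (Fin n) (Fin n) ℂ}
    (hA : A.PosSemidef) : (hsAdjoint Φ A).PosSemidef := by
  refine .of_dotProduct_mulVec_nonneg ?_ fun v => ?_
  · exact (hsAdjoint_conjTranspose (map_conjTranspose_of_map_nonneg hΦ) A).symm.trans (by rw [hA.1])
  · have hX := posSemidef_vecMulVec_self_star v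
    have hquad : star v ⬝ᵥ hsAdjoint Φ A *ᵥ v = (Φ (vecMulVec v (star v)) * A).trace := by
      have h := trace_hsAdjoint Φ (vecMulVec v (star v)) A
      rwa [← map_conjTranspose_of_map_nonneg hΦ, hX.1.eq, vecMulVec_mul, trace_vecMulVec,
        dotProduct_comm, ← dotProduct_mulVec] at h
    rw [hquad]
    simpa using trace_mul_le_of_le (hΦ _ hX.nonneg) hA

theorem IsSchwarz.map_nonneg (hΦ : IsSchwarz Φ) (X : Matrix (Fin m) (Fin m) ℂ) (hX : 0 ≤ X) :
    0 ≤ Φ X := by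
  obtain ⟨K, rfl⟩ := CStarAlgebra.nonneg_iff_eq_star_mul_self.1 hX
  exact (star_mul_self_nonneg (Φ K)).trans (hΦ K)

theorem IsSchwarz.map_one_le_one (hΦ : IsSchwarz Φ) : Φ 1 ≤ 1 := by
  have hstar : (Φ 1)ᴴ = Φ 1 := by
    simpa using (map_conjTranspose_of_map_nonneg hΦ.map_nonneg 1).symm
  have hle : Φ 1 * Φ 1 ≤ Φ 1 := by simpa [hstar, Matrix.le_iff] using hΦ 1
  have hsq : 0 ≤ (1 - Φ 1) * (1 - Φ 1) := by
    simpa [hstar, star_eq_conjTranspose] using star_mul_self_nonneg (1 - Φ 1)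
  calc Φ 1 ≤ Φ 1 + ((1 - Φ 1) * (1 - Φ 1) + (Φ 1 - Φ 1 * Φ 1)) :=
        le_add_of_nonneg_right (add_nonneg hsq (sub_nonneg.2 hle))
    _ = 1 := by noncomm_ring

theorem IsSchwarz.re_trace_hsAdjoint_le (hΦ : IsSchwarz Φ) {Z : Matrix (Fin n) (Fin n) ℂ}
    (hZ : Z.PosSemidef) : (hsAdjoint Φ Z).trace.re ≤ Z.trace.re := by
  have h := trace_hsAdjoint Φ 1 Z
  rw [← map_conjTranspose_of_map_nonneg hΦ.map_nonneg, conjTranspose_one, one_mul] at h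
  rw [h]
  simpa using re_trace_mul_le_of_le hΦ.map_one_le_one hZ

theorem IsSchwarz.leftRightForm_one_left_map_le (hΦ : IsSchwarz Φ) {Z : Matrix (Fin n) (Fin n) ℂ}
    (hZ : Z.PosSemidef) (K : Matrix (Fin m) (Fin m) ℂ) :
    leftRightForm 1 Z (Φ K) ≤ leftRightForm 1 (hsAdjoint Φ Z) K := by
  have htrace := trace_hsAdjoint Φ (Kᴴ * K) Z
  rw [← map_conjTranspose_of_map_nonneg hΦ.map_nonneg, conjTranspose_mul,
    conjTranspose_conjTranspose] at htrace
  simp only [leftRightForm, one_mul, ← Matrix.mul_assoc, htrace]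
  exact re_trace_mul_le_of_le (hΦ K) hZ

theorem IsSchwarz.leftRightForm_one_right_map_le (hΦ : IsSchwarz Φ)
    {A : Matrix (Fin n) (Fin n) ℂ} (hA : A.PosSemidef) (K : Matrix (Fin m) (Fin m) ℂ) :
    leftRightForm A 1 (Φ K) ≤ leftRightForm (hsAdjoint Φ A) 1 K := by
  have h := hΦ.leftRightForm_one_left_map_le hA Kᴴ
  rwa [map_conjTranspose_of_map_nonneg hΦ.map_nonneg, leftRightForm_conjTranspose,
    leftRightForm_conjTranspose] at h

theorem IsSchwarz.leftRightForm_rpow_neg_hsAdjoint_le (hΦ : IsSchwarz Φ)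
    {A Z : Matrix (Fin n) (Fin n) ℂ} {Z' : Matrix (Fin m) (Fin m) ℂ}
    (hA : A.PosDef) (hZ : Z.PosDef) (hZ' : hsAdjoint Φ Z ≤ Z')
    {p : ℝ} (hp : p ∈ Set.Icc 0 1) (B : Matrix (Fin n) (Fin n) ℂ) :
    leftRightForm (hsAdjoint Φ A ^ (-p)) (Z' ^ (-(1 - p))) (hsAdjoint Φ B) ≤
      leftRightForm (A ^ (-p)) (Z ^ (-(1 - p))) B := by
  have hAdj := posSemidef_hsAdjoint hΦ.map_nonneg hA.posSemidef
  have hZ'0 : Z'.PosSemidef := nonneg_iff_posSemidef.1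
    ((posSemidef_hsAdjoint hΦ.map_nonneg hZ.posSemidef).nonneg.trans hZ')
  have hΦZ (K : Matrix (Fin m) (Fin m) ℂ) : leftRightForm 1 Z (Φ K) ≤ leftRightForm 1 Z' K := by
    refine (hΦ.leftRightForm_one_left_map_le hZ.posSemidef K).trans ?_
    simp only [leftRightForm, one_mul, ← Matrix.mul_assoc]
    rw [Matrix.trace_mul_comm (Kᴴ * K), Matrix.trace_mul_comm (Kᴴ * K)]
    exact re_trace_mul_le_of_le hZ' (posSemidef_conjTranspose_mul_self K)
  refine leftRightForm_rpow_neg_le_of_map_le (Φ := Φ) hAdj hZ'0 hA hZ (fun K => ?_) ?_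
  · rw [trace_hsAdjoint]
  · exact leftRightForm_rpow_map_le Φ.toAddMonoidHom hAdj hZ'0 hA.posSemidef hZ.posSemidef
      (hΦ.leftRightForm_one_right_map_le hA.posSemidef) hΦZ hp

theorem IsSchwarz.re_trace_rpow_hsAdjoint_le (hΦ : IsSchwarz Φ) {A Z : Matrix (Fin n) (Fin n) ℂ}
    (hA : A.PosDef) (hZ : Z.PosDef) {p : ℝ} (hp : p ∈ Set.Icc 0 1)
    (B : Matrix (Fin n) (Fin n) ℂ) {s : ℝ} (hs : s⁻¹ = 2 - p) :
    (((hsAdjoint Φ B)ᴴ * hsAdjoint Φ A ^ (-p) * hsAdjoint Φ B) ^ s).trace.re ≤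
      s * (Bᴴ * A ^ (-p) * B * Z ^ (1 - s⁻¹)).trace.re + (1 - s) * Z.trace.re := by
  have hs0 : 0 < s := inv_pos.1 (by linarith [hp.2])
  have hs1 : s ≤ 1 := (one_le_inv₀ hs0).1 (by linarith [hp.2])
  have hexp : 1 - s⁻¹ = -(1 - p) := by rw [hs]; ring
  refine le_of_forall_pos_le_add_mul
    (c := (1 - s) * (1 : Matrix (Fin m) (Fin m) ℂ).trace.re) fun ε hε => ?_
  -- `hsAdjoint Φ Z` may be singular, while the variational bound needs a positive definite matrix.
  let Z' := hsAdjoint Φ Z + ε • (1 : Matrix (Fin m) (Fin m) ℂ)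
  have hZ' : Z'.PosDef :=
    .posSemidef_add (posSemidef_hsAdjoint hΦ.map_nonneg hZ.posSemidef) (PosDef.one.smul hε)
  have hle : hsAdjoint Φ Z ≤ Z' := le_add_of_nonneg_right (smul_nonneg hε.le zero_le_one)
  have hform : ((hsAdjoint Φ B)ᴴ * hsAdjoint Φ A ^ (-p) * hsAdjoint Φ B *
      Z' ^ (1 - s⁻¹)).trace.re ≤ (Bᴴ * A ^ (-p) * B * Z ^ (1 - s⁻¹)).trace.re := by
    simpa only [hexp, ← re_trace_conjTranspose_mul_mul_mul, RCLike.re_eq_complex_re] using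
      hΦ.leftRightForm_rpow_neg_hsAdjoint_le hA hZ hle hp B
  have htrace : Z'.trace.re ≤ Z.trace.re + ε * (1 : Matrix (Fin m) (Fin m) ℂ).trace.re := by
    simpa [Z'] using hΦ.re_trace_hsAdjoint_le hZ.posSemidef
  have hpsd : ((hsAdjoint Φ B)ᴴ * hsAdjoint Φ A ^ (-p) * hsAdjoint Φ B).PosSemidef :=
    (nonneg_iff_posSemidef.1 CFC.rpow_nonneg).conjTranspose_mul_mul_same _
  calc (((hsAdjoint Φ B)ᴴ * hsAdjoint Φ A ^ (-p) * hsAdjoint Φ B) ^ s).trace.re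
      ≤ s * ((hsAdjoint Φ B)ᴴ * hsAdjoint Φ A ^ (-p) * hsAdjoint Φ B *
          Z' ^ (1 - s⁻¹)).trace.re + (1 - s) * Z'.trace.re := re_trace_rpow_le hpsd hZ' hs0 hs1
    _ ≤ s * (Bᴴ * A ^ (-p) * B * Z ^ (1 - s⁻¹)).trace.re + (1 - s) *
          (Z.trace.re + ε * (1 : Matrix (Fin m) (Fin m) ℂ).trace.re) :=
        add_le_add (mul_le_mul_of_nonneg_left hform hs0.le)
          (mul_le_mul_of_nonneg_left htrace (sub_nonneg.2 hs1))
    _ = s * (Bᴴ * A ^ (-p) * B * Z ^ (1 - s⁻¹)).trace.re + (1 - s) * Z.trace.re +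
          ε * ((1 - s) * (1 : Matrix (Fin m) (Fin m) ℂ).trace.re) := by ring

end Schwarz

end SchwarzMono

theorem theorem4p1_general (m n : ℕ) (p : ℝ) (hp : p ∈ Set.Icc 0 1)
    (Φ : Matrix (Fin m) (Fin m) ℂ →ₗ[ℂ] Matrix (Fin n) (Fin n) ℂ)
    (hschwarz : SchwarzMono.IsSchwarz Φ) (A B : Matrix (Fin n) (Fin n) ℂ) (hA : A.PosDef) :
    ((((SchwarzMono.hsAdjoint Φ B)ᴴ * (SchwarzMono.hsAdjoint Φ A) ^ (-p) *
        SchwarzMono.hsAdjoint Φ B) ^ (1 / (2 - p))).trace).re ≤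
      (((Bᴴ * A ^ (-p) * B) ^ (1 / (2 - p))).trace).re := by
  have hp2 : 1 ≤ 2 - p := by linarith [hp.2]
  have hs0 : 0 < 1 / (2 - p) := one_div_pos.2 (zero_lt_one.trans_le hp2)
  have hs1 : 1 / (2 - p) ≤ 1 := (div_le_one (zero_lt_one.trans_le hp2)).2 hp2
  have hpsd : (Bᴴ * A ^ (-p) * B).PosSemidef :=
    (nonneg_iff_posSemidef.1 CFC.rpow_nonneg).conjTranspose_mul_mul_same B
  refine (le_isGLB_iff (SchwarzMono.isGLB_re_trace_rpow hpsd hs0 hs1)).2 ?_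
  rintro _ ⟨Z, hZ, rfl⟩
  exact hschwarz.re_trace_rpow_hsAdjoint_le hA hZ hp B (by rw [one_div, inv_inv])

/-- Real powers `X ^ y` are those of the continuous functional calculus.  On the singular positive
semidefinite matrices the convention is `0 ^ y = 0` for `y ≠ 0` on the kernel, so that a negative
power is the corresponding power of the Moore-Penrose generalized inverse. -/
theorem theorem4p1 (m n : ℕ) (p : ℝ) (hp0 : 0 < p) (hp1 : p < 1)
    (Φ : Matrix (Fin m) (Fin m) ℂ →ₗ[ℂ] Matrix (Fin n) (Fin n) ℂ)
    (hunital : SchwarzMono.IsUnital Φ) (hschwarz : SchwarzMono.IsSchwarz Φ)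
    (A B : Matrix (Fin n) (Fin n) ℂ) (hA : A.PosDef) (hB : IsUnit B) :
    ((((SchwarzMono.hsAdjoint Φ B)ᴴ * (SchwarzMono.hsAdjoint Φ A) ^ (-p) *
        SchwarzMono.hsAdjoint Φ B) ^ (1 / (2 - p))).trace).re ≤
      (((Bᴴ * A ^ (-p) * B) ^ (1 / (2 - p))).trace).re :=
  theorem4p1_general m n p ⟨hp0.le, hp1.le⟩ Φ hschwarz A B hA
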